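/- For positive integers $a_1,\dots,a_n$ let $[a_1,\dots,a_n]=\cfrac{1}{a_1+\cfrac{1}{\ddots+\cfrac{1}{a_n}}}$, and let $I_{[a_1,\dots,a_n]}$ be the open interval whose endpoints are $[a_1,\dots,a_n]$ and $[a_1,\dots,a_{n-1},a_n+1]$ (a \emph{cf-ary interval}); for $n=0$ it is $(0,1)$. Let $T$ be the Gauss map, $T(0)=0$ and $T(x)=1/x-\lfloor 1/x\rfloor$ otherwise, and let $\mu$ be the Gauss measure on $(0,1)$, $\mu(\mathrm dx)=\dfrac{\mathrm dx}{(1+x)\log 2}$. Here $\log$ is the natural logarithm, $|S|$ is the Lebesgue measure of $S$, and $\mathbb I_I$ is the characteristic function of $I$. \textbf{Lemma.} Let $I_{[a_1,\dots,a_r]}$, $r\ge 0$, be a cf-ary interval and let $b_1,\dots,b_k$ be a block of $k\ge 1$ positive integers. Then for every real $\delta>0$, every positive integer $n$, and every real $M>0$ with $$M\ \ge\ \Big\lceil k-\log\big(\delta^2/(2\log 2)\big)\Big\rceil ,$$ we have $$\Big|\Big\{x\in I_{[a_1,\dots,a_r]}:\ \Big|\frac1n\sum_{i=0}^{n-1}\mathbb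 I_{I_{[b_1,\dots,b_k]}}(T^{r+i}x)-\mu(I_{[b_1,\dots,b_k]})\Big|>\delta\Big\}\Big|\ \le\ 6M\,e^{-\frac{\delta^2 n}{2M}}\,\big|I_{[a_1,\dots,a_r]}\big| .$$ -/

import Mathlib

/-- The finite continued fraction `[a₁, …, aₙ₋₁, aₙ + t] = 1/(a₁ + 1/(a₂ + ⋯ + 1/(aₙ + t)))`
with positive integer digits `a₁, …, aₙ`. In particular `t = 0` gives `[a₁, …, aₙ]` and
`t = 1` gives `[a₁, …, aₙ + 1]`. -/
noncomputable def cfEval : List ℕ+ → ℝ → ℝ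
  | [], t => t
  | a :: l, t => 1 / (((a : ℕ) : ℝ) + cfEval l t)

/-- The cf-ary interval `I_[a₁, …, aₙ]`: the open interval whose endpoints, in increasing order,
are `[a₁, …, aₙ]` and `[a₁, …, aₙ + 1]`. For the empty list it is `(0, 1)`. -/
noncomputable def cfInterval (a : List ℕ+) : Set ℝ :=
  Set.Ioo (min (cfEval a 0) (cfEval a 1)) (max (cfEval a 0) (cfEval a 1))

/-- The Gauss map `T x = 1/x - ⌊1/x⌋`, with `T 0 = 0` (in Lean `1 / 0 = 0`). -/
noncomputable def gaussMap (x : ℝ) : ℝ := 1 / x - (⌊1 / x⌋ : ℝ)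

/-- The Gauss measure on the unit interval, with density `1 / ((1 + x) log 2)`. -/
noncomputable def gaussMeasure : MeasureTheory.Measure ℝ :=
  (MeasureTheory.volume.restrict (Set.Ioo (0 : ℝ) 1)).withDensity
    (fun x => ENNReal.ofReal (1 / ((1 + x) * Real.log 2)))

/-- The frequency `(1/n) ∑_{i < n} 𝟙_{I_b}(T^{r+i} x)` with which the block `b` occurs in the
continued fraction expansion of `x`, at the `n` positions that follow the first `r` digits. -/
noncomputable def cfBlockFreq (b : List ℕ+) (r n : ℕ) (x : ℝ) : ℝ :=
  (1 / (n : ℝ)) *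
    ∑ i ∈ Finset.range n, (cfInterval b).indicator (fun _ => (1 : ℝ)) (gaussMap^[r + i] x)

/-! Once the first r digits of a Lebesgue-random x in (0, 1) are fixed, the tail T^r x has density
(1+θ)/(1+θx)² with θ = q_{r-1}/q_r in [0, 1], and one more digit d replaces θ by 1/(d+θ). The digits
are thus driven by a Markov chain in θ (`lintegral_cfLaw_eq_tsum`); Lebesgue measure is the start θ
= 0.

The chain forgets its start. Its transition operator turns increasing functions into decreasing ones
and halves their oscillation (`antitoneOn_digitOperator`, `digitOperator_zero_sub_one_le`).
Distribution functions are increasing in θ with oscillation at most 1/4, and the Gauss measure is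
T-invariant and a mixture of these laws. Hence T^m x falls in I_b with probability within 2^{-m}/4
of μ(I_b), uniformly in θ (`abs_cfLaw_real_sub_gaussMeasure_real_le`).

Now split the n positions into classes modulo K = m + k. Within a class, consecutive blocks are
separated by m free digits, so Hoeffding's lemma applies conditionally with a small bias, and the
conditional exponential moments multiply (`lintegral_prod_exp_succ_le`). A Chernoff bound for each
class and a union bound over the K classes give `cfLaw_real_deviation_le`;
`exists_cfLaw_cfInterval_inter` transfers it to I_a. -/

open MeasureTheory Set Filter Topology
open scoped ENNReal

/-! ### Inverse branches of the Gauss map -/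

/-- The inverse branch `y ↦ 1 / (n + 1 + y)` of the Gauss map. -/
noncomputable def cfBranch (n : ℕ) (y : ℝ) : ℝ := 1 / ((n : ℝ) + 1 + y)

lemma measurable_cfBranch (n : ℕ) : Measurable (cfBranch n) := by
  unfold cfBranch; fun_prop

lemma measurable_gaussMap : Measurable gaussMap := by
  unfold gaussMap; fun_prop

lemma cfBranch_mem_Ioo (n : ℕ) {y : ℝ} (hy : y ∈ Ioo (0 : ℝ) 1) : cfBranch n y ∈ Ioo (0 : ℝ) 1 := by
  have hn : (0 : ℝ) ≤ n := n.cast_nonneg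
  have h0 := hy.1
  refine ⟨by unfold cfBranch; positivity, ?_⟩
  unfold cfBranch
  rw [div_lt_one (by positivity)]
  linarith

lemma cfBranch_mem_Icc (n : ℕ) {y : ℝ} (hy : y ∈ Icc (0 : ℝ) 1) : cfBranch n y ∈ Icc (0 : ℝ) 1 := by
  have hn : (0 : ℝ) ≤ n := n.cast_nonneg
  have h0 := hy.1
  refine ⟨by unfold cfBranch; positivity, ?_⟩
  unfold cfBranch
  rw [div_le_one (by positivity)]
  linarith

lemma gaussMap_cfBranch (n : ℕ) {y : ℝ} (hy : y ∈ Ioo (0 : ℝ) 1) : gaussMap (cfBranch n y) = y := by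
  have h : ⌊(n : ℝ) + 1 + y⌋ = (n : ℤ) + 1 := by
    rw [Int.floor_eq_iff]
    push_cast
    constructor <;> linarith [hy.1, hy.2]
  unfold gaussMap cfBranch
  rw [one_div_one_div, h]
  push_cast
  ring

lemma gaussMap_iterate_succ_cfBranch (m n : ℕ) {y : ℝ} (hy : y ∈ Ioo (0 : ℝ) 1) :
    gaussMap^[m + 1] (cfBranch n y) = gaussMap^[m] y := by
  rw [Function.iterate_succ_apply, gaussMap_cfBranch n hy]

lemma cfBranch_injOn (n : ℕ) : InjOn (cfBranch n) (Ioo 0 1) := fun x hx y hy h => by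
  rw [← gaussMap_cfBranch n hx, ← gaussMap_cfBranch n hy, h]

lemma pairwise_disjoint_image_cfBranch :
    Pairwise (Function.onFun Disjoint fun n => cfBranch n '' Ioo 0 1) := by
  intro m n hmn
  rw [Function.onFun, Set.disjoint_left]
  rintro _ ⟨x, hx, rfl⟩ ⟨y, hy, h⟩
  have h' : (n : ℝ) + 1 + y = m + 1 + x := by
    unfold cfBranch at h
    simpa using h
  apply hmn
  have h1 : (m : ℝ) < n + 1 := by linarith [hx.1, hy.2]
  have h2 : (n : ℝ) < m + 1 := by linarith [hx.2, hy.1]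
  norm_cast at h1 h2
  omega

lemma hasDerivAt_cfBranch (n : ℕ) {y : ℝ} (hy : 0 < y) :
    HasDerivAt (cfBranch n) (-(1 / ((n : ℝ) + 1 + y) ^ 2)) y := by
  have h : (n : ℝ) + 1 + y ≠ 0 := by positivity
  have h1 : HasDerivAt (fun y : ℝ => (n : ℝ) + 1 + y) 1 y := (hasDerivAt_id y).const_add _
  have h2 : cfBranch n = (fun y : ℝ => (n : ℝ) + 1 + y)⁻¹ := by
    ext z
    simp [cfBranch]
  rw [h2, ← neg_div]
  exact h1.inv h

/-- The branches miss only reciprocals of integers, a countable set. -/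
lemma iUnion_image_cfBranch_ae_eq :
    (⋃ n, cfBranch n '' Ioo 0 1) =ᵐ[volume] Ioo (0 : ℝ) 1 := by
  have hsub : (⋃ n, cfBranch n '' Ioo 0 1) ⊆ Ioo (0 : ℝ) 1 := by
    rintro _ ⟨_, ⟨n, rfl⟩, y, hy, rfl⟩
    exact cfBranch_mem_Ioo n hy
  have hcount : (range fun n : ℕ => 1 / (n : ℝ)).Countable := countable_range _
  refine ae_eq_set.2 ⟨by rw [sdiff_eq_empty.2 hsub, measure_empty],
    measure_mono_null (t := range fun n : ℕ => 1 / (n : ℝ)) ?_ (hcount.measure_zero volume)⟩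
  rintro x ⟨hx, hxn⟩
  have hx1 : 1 < 1 / x := (one_lt_div hx.1).2 hx.2
  have hfl : 1 ≤ ⌊1 / x⌋ := Int.le_floor.2 (by exact_mod_cast hx1.le)
  obtain ⟨n, hn⟩ := Int.eq_ofNat_of_zero_le (sub_nonneg.2 hfl)
  have hn' : (⌊1 / x⌋ : ℝ) = n + 1 := by
    have : ⌊1 / x⌋ = n + 1 := by linarith
    rw [this]
    push_cast
    rfl
  have hle := Int.floor_le (1 / x)
  have hlt := Int.lt_floor_add_one (1 / x)
  rw [hn'] at hle hlt
  rcases hle.eq_or_lt with h | h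
  · refine ⟨n + 1, ?_⟩
    push_cast
    rw [h, one_div_one_div]
  · have hy : 1 / x - (n + 1) ∈ Ioo (0 : ℝ) 1 := ⟨by linarith, by linarith⟩
    have hxy : cfBranch n (1 / x - (n + 1)) = x := by
      rw [cfBranch, add_sub_cancel, one_div_one_div]
    exact absurd (mem_iUnion.2 ⟨n, hxy ▸ mem_image_of_mem (cfBranch n) hy⟩) hxn

theorem lintegral_Ioo_eq_tsum_cfBranch (F : ℝ → ℝ≥0∞) :
    ∫⁻ x in Ioo 0 1, F x =
      ∑' n : ℕ, ∫⁻ y in Ioo 0 1, ENNReal.ofReal (1 / ((n : ℝ) + 1 + y) ^ 2) * F (cfBranch n y) := by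
  have hmeas : ∀ n, MeasurableSet (cfBranch n '' Ioo 0 1) := fun n =>
    measurableSet_Ioo.image_of_measurable_injOn (measurable_cfBranch n) (cfBranch_injOn n)
  rw [← setLIntegral_congr iUnion_image_cfBranch_ae_eq,
    lintegral_iUnion hmeas pairwise_disjoint_image_cfBranch]
  refine tsum_congr fun n => ?_
  rw [lintegral_image_eq_lintegral_abs_deriv_mul measurableSet_Ioo
    (fun y hy => (hasDerivAt_cfBranch n hy.1).hasDerivWithinAt) (cfBranch_injOn n)]
  refine setLIntegral_congr_fun measurableSet_Ioo fun y hy => ?_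
  rw [abs_neg, abs_of_nonneg (by positivity)]

/-! ### Conditional laws of the tail -/

/-- The density of the conditional law of `T^r x` given the first `r` digits of `x`,
where `θ = q_{r-1} / q_r`. -/
noncomputable def cfDensity (θ x : ℝ) : ℝ := (1 + θ) / (1 + θ * x) ^ 2

/-- The conditional law with density `cfDensity θ` on the unit interval. -/
noncomputable def cfLaw (θ : ℝ) : Measure ℝ :=
  (volume.restrict (Ioo (0 : ℝ) 1)).withDensity fun x => ENNReal.ofReal (cfDensity θ x)

/-- The probability of the first digit being `n + 1` under `cfLaw θ`. -/
noncomputable def digitWeight (n : ℕ) (θ : ℝ) : ℝ :=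
  (1 + θ) / (((n : ℝ) + 1 + θ) * ((n : ℝ) + 2 + θ))

lemma measurable_cfDensity (θ : ℝ) : Measurable (cfDensity θ) := by
  unfold cfDensity; fun_prop

lemma digitWeight_nonneg (n : ℕ) {θ : ℝ} (hθ : 0 ≤ θ) : 0 ≤ digitWeight n θ := by
  unfold digitWeight; positivity

lemma lintegral_cfLaw (θ : ℝ) {f : ℝ → ℝ≥0∞} (hf : Measurable f) :
    ∫⁻ x, f x ∂cfLaw θ = ∫⁻ x in Ioo 0 1, ENNReal.ofReal (cfDensity θ x) * f x := by
  rw [cfLaw, lintegral_withDensity_eq_lintegral_mul _ (measurable_cfDensity θ).ennreal_ofReal hf]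
  rfl

lemma lintegral_cfLaw_congr (θ : ℝ) {f g : ℝ → ℝ≥0∞} (h : ∀ x ∈ Ioo (0 : ℝ) 1, f x = g x) :
    ∫⁻ x, f x ∂cfLaw θ = ∫⁻ x, g x ∂cfLaw θ := by
  apply lintegral_congr_ae
  apply (withDensity_absolutelyContinuous _ _).ae_le
  filter_upwards [ae_restrict_mem measurableSet_Ioo] with x hx using h x hx

/-- Substituting x = 1/(n+1+y) turns the density for θ into `digitWeight n θ` times the density for
1/(n+1+θ): the family is closed under conditioning on a digit. This is the Markov property. -/
theorem lintegral_cfLaw_eq_tsum {θ : ℝ} (hθ : 0 ≤ θ) {f : ℝ → ℝ≥0∞} (hf : Measurable f) :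
    ∫⁻ x, f x ∂cfLaw θ = ∑' n : ℕ, ENNReal.ofReal (digitWeight n θ) *
      ∫⁻ y, f (cfBranch n y) ∂cfLaw (cfBranch n θ) := by
  rw [lintegral_cfLaw θ hf, lintegral_Ioo_eq_tsum_cfBranch]
  refine tsum_congr fun n => ?_
  rw [lintegral_cfLaw _ (show Measurable fun y => f (cfBranch n y) from
    hf.comp (measurable_cfBranch n)), ← lintegral_const_mul' _ _ ENNReal.ofReal_ne_top]
  refine setLIntegral_congr_fun measurableSet_Ioo fun y hy => ?_
  have hy0 := hy.1
  rw [← mul_assoc, ← mul_assoc, ← ENNReal.ofReal_mul (by positivity),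
    ← ENNReal.ofReal_mul (digitWeight_nonneg n hθ)]
  congr 2
  unfold cfDensity cfBranch digitWeight
  field_simp
  ring

lemma hasDerivAt_cfDensity_primitive {θ x : ℝ} (hθ : 0 ≤ θ) (hx : 0 ≤ x) :
    HasDerivAt (fun x => (1 + θ) * x / (1 + θ * x)) (cfDensity θ x) x := by
  have h : 1 + θ * x ≠ 0 := by positivity
  have h1 : HasDerivAt (fun x : ℝ => (1 + θ) * x) (1 + θ) x := by
    simpa using (hasDerivAt_id x).const_mul (1 + θ)
  have h2 : HasDerivAt (fun x : ℝ => 1 + θ * x) θ x := by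
    simpa using ((hasDerivAt_id x).const_mul θ).const_add 1
  have h3 : cfDensity θ x = ((1 + θ) * (1 + θ * x) - (1 + θ) * x * θ) / (1 + θ * x) ^ 2 := by
    unfold cfDensity
    ring
  rw [h3]
  exact h1.div h2 h

lemma lintegral_Ioo_cfDensity {θ a b : ℝ} (hθ : 0 ≤ θ) (ha : 0 ≤ a) (hab : a ≤ b) :
    ∫⁻ x in Ioo a b, ENNReal.ofReal (cfDensity θ x) =
      ENNReal.ofReal ((1 + θ) * b / (1 + θ * b) - (1 + θ) * a / (1 + θ * a)) := by
  have hcont : ContinuousOn (cfDensity θ) (Icc a b) := by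
    refine ContinuousOn.div (by fun_prop) (by fun_prop) fun x hx => ?_
    have : 0 ≤ x := ha.trans hx.1
    positivity
  rw [setLIntegral_congr Ioo_ae_eq_Ioc, ← ofReal_integral_eq_lintegral_ofReal,
    ← intervalIntegral.integral_of_le hab, intervalIntegral.integral_eq_sub_of_hasDerivAt]
  · intro x hx
    rw [uIcc_of_le hab] at hx
    exact hasDerivAt_cfDensity_primitive hθ (ha.trans hx.1)
  · rw [← uIcc_of_le hab] at hcont
    exact hcont.intervalIntegrable
  · exact hcont.integrableOn_Icc.mono_set Ioc_subset_Icc_self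
  · filter_upwards with x
    unfold cfDensity
    positivity

lemma cfLaw_Ioo {θ a b : ℝ} (hθ : 0 ≤ θ) (ha : 0 ≤ a) (hab : a ≤ b) (hb : b ≤ 1) :
    cfLaw θ (Ioo a b) =
      ENNReal.ofReal ((1 + θ) * b / (1 + θ * b) - (1 + θ) * a / (1 + θ * a)) := by
  rw [cfLaw, withDensity_apply _ measurableSet_Ioo, Measure.restrict_restrict measurableSet_Ioo,
    inter_eq_left.2 (Ioo_subset_Ioo ha hb), lintegral_Ioo_cfDensity hθ ha hab]

lemma isProbabilityMeasure_cfLaw {θ : ℝ} (hθ : 0 ≤ θ) : IsProbabilityMeasure (cfLaw θ) := by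
  constructor
  rw [cfLaw, withDensity_apply _ MeasurableSet.univ, Measure.restrict_univ,
    lintegral_Ioo_cfDensity hθ le_rfl zero_le_one]
  have : 1 + θ ≠ 0 := by positivity
  simp [this]

lemma cfLaw_zero : cfLaw 0 = volume.restrict (Ioo 0 1) := by
  simp [cfLaw, cfDensity]

/-! ### Functions of finitely many digits -/

/-- `f` is determined on `(0, 1)` by the first `k` continued fraction digits. -/
def DependsOnDigits {α : Type*} : ℕ → (ℝ → α) → Prop
  | 0, f => ∃ c, ∀ x ∈ Ioo (0 : ℝ) 1, f x = c
  | k + 1, f => ∀ n, DependsOnDigits k fun y => f (cfBranch n y)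

lemma DependsOnDigits.congr {α : Type*} {k : ℕ} {f g : ℝ → α} (hf : DependsOnDigits k f)
    (h : ∀ x ∈ Ioo (0 : ℝ) 1, f x = g x) : DependsOnDigits k g := by
  induction k generalizing f g with
  | zero =>
    obtain ⟨c, hc⟩ := hf
    exact ⟨c, fun x hx => (h x hx).symm.trans (hc x hx)⟩
  | succ k ih => exact fun n => ih (hf n) fun y hy => h _ (cfBranch_mem_Ioo n hy)

lemma dependsOnDigits_const {α : Type*} (k : ℕ) (c : α) :
    DependsOnDigits k fun _ => c := by
  induction k with
  | zero => exact ⟨c, fun _ _ => rfl⟩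
  | succ k ih => exact fun _ => ih

lemma DependsOnDigits.map {α β : Type*} (φ : α → β) {k : ℕ} {f : ℝ → α}
    (hf : DependsOnDigits k f) : DependsOnDigits k fun x => φ (f x) := by
  induction k generalizing f with
  | zero =>
    obtain ⟨c, hc⟩ := hf
    exact ⟨φ c, fun x hx => congrArg φ (hc x hx)⟩
  | succ k ih => exact fun n => ih (hf n)

lemma DependsOnDigits.comp_gaussMap_iterate {α : Type*} {k : ℕ} {f : ℝ → α}
    (hf : DependsOnDigits k f) (m : ℕ) : DependsOnDigits (m + k) fun x => f (gaussMap^[m] x) := by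
  induction m with
  | zero => simpa using hf
  | succ m ih =>
    rw [Nat.add_right_comm]
    exact fun n => ih.congr fun y hy => congrArg f (gaussMap_iterate_succ_cfBranch m n hy).symm

/-- After k digits are peeled off, f is constant and the tail still follows some `cfLaw θ`, so the
bound on G, being uniform in θ, applies on each piece. -/
theorem DependsOnDigits.lintegral_mul_le {k : ℕ} {f G : ℝ → ℝ≥0∞} (hf : DependsOnDigits k f)
    (hfm : Measurable f) (hGm : Measurable G) {C : ℝ≥0∞}
    (hC : ∀ θ ∈ Icc (0 : ℝ) 1, ∫⁻ x, G x ∂cfLaw θ ≤ C) {θ : ℝ} (hθ : θ ∈ Icc (0 : ℝ) 1) :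
    ∫⁻ x, f x * G (gaussMap^[k] x) ∂cfLaw θ ≤ (∫⁻ x, f x ∂cfLaw θ) * C := by
  induction k generalizing f θ with
  | zero =>
    obtain ⟨c, hc⟩ := hf
    have := isProbabilityMeasure_cfLaw hθ.1
    rw [lintegral_cfLaw_congr θ hc, lintegral_const, measure_univ, mul_one,
      lintegral_cfLaw_congr θ (g := fun x => c * G x) fun x hx => by simp [hc x hx],
      lintegral_const_mul _ hGm]
    gcongr
    exact hC θ hθ
  | succ k ih =>
    rw [lintegral_cfLaw_eq_tsum hθ.1 (show Measurable fun x => f x * G (gaussMap^[k + 1] x) from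
      hfm.mul (hGm.comp (measurable_gaussMap.iterate _))),
      lintegral_cfLaw_eq_tsum hθ.1 hfm, ← ENNReal.tsum_mul_right]
    refine ENNReal.tsum_le_tsum fun n => ?_
    rw [mul_assoc]
    gcongr
    rw [lintegral_cfLaw_congr _ (g := fun y => f (cfBranch n y) * G (gaussMap^[k] y)) fun y hy => by
      rw [gaussMap_iterate_succ_cfBranch k n hy]]
    exact ih (hf n) (hfm.comp (measurable_cfBranch n)) (cfBranch_mem_Icc n hθ)

/-! ### Cf-ary intervals and conditioning on them -/

lemma cfEval_mem_Icc (l : List ℕ+) {t : ℝ} (ht : t ∈ Icc (0 : ℝ) 1) : cfEval l t ∈ Icc (0 : ℝ) 1 := by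
  induction l with
  | nil => exact ht
  | cons a l ih =>
    have ha : (1 : ℝ) ≤ (a : ℕ) := by exact_mod_cast a.pos
    have := ih.1
    refine ⟨by rw [cfEval]; positivity, ?_⟩
    rw [cfEval, div_le_one (by positivity)]
    linarith

lemma cfInterval_subset (l : List ℕ+) : cfInterval l ⊆ Ioo 0 1 := by
  have h0 := cfEval_mem_Icc l (left_mem_Icc.2 zero_le_one)
  have h1 := cfEval_mem_Icc l (right_mem_Icc.2 zero_le_one)
  exact Ioo_subset_Ioo (le_min h0.1 h1.1) (max_le h0.2 h1.2)

lemma cfInterval_nil : cfInterval [] = Ioo 0 1 := by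
  simp [cfInterval, cfEval]

lemma measurableSet_cfInterval (l : List ℕ+) : MeasurableSet (cfInterval l) := measurableSet_Ioo

/-- Inversion reverses order, so prefixing a digit swaps the two endpoint inequalities; `min` and
`max` absorb the parity. Since y is strictly inside (0, 1), the integer parts must agree. -/
lemma cfBranch_mem_cfInterval_cons (n : ℕ) (a : ℕ+) (l : List ℕ+) {y : ℝ}
    (hy : y ∈ Ioo (0 : ℝ) 1) :
    cfBranch n y ∈ cfInterval (a :: l) ↔ (a : ℕ) = n + 1 ∧ y ∈ cfInterval l := by
  have h0 := cfEval_mem_Icc l (left_mem_Icc.2 zero_le_one)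
  have h1 := cfEval_mem_Icc l (right_mem_Icc.2 zero_le_one)
  have hy0 := hy.1
  have ha : (1 : ℝ) ≤ (a : ℕ) := by exact_mod_cast a.pos
  have ha0 : 0 < ((a : ℕ) : ℝ) + cfEval l 0 := by linarith [h0.1]
  have ha1 : 0 < ((a : ℕ) : ℝ) + cfEval l 1 := by linarith [h1.1]
  have hny : 0 < (n : ℝ) + 1 + y := by positivity
  simp only [cfInterval, mem_Ioo, cfEval, cfBranch, min_lt_iff, lt_max_iff,
    one_div_lt_one_div ha0 hny, one_div_lt_one_div ha1 hny, one_div_lt_one_div hny ha0,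
    one_div_lt_one_div hny ha1]
  constructor
  · rintro ⟨hl, hr⟩
    have han : (a : ℕ) = n + 1 := by
      have e1 : ((a : ℕ) : ℝ) < n + 2 := by
        rcases hl with h | h <;> rcases hr with h' | h' <;> linarith [h0.1, h1.1, hy.2]
      have e2 : (n : ℝ) < (a : ℕ) := by
        rcases hl with h | h <;> rcases hr with h' | h' <;> linarith [h0.2, h1.2, hy.1]
      norm_cast at e1 e2
      omega
    refine ⟨han, ?_⟩
    rw [han] at hl hr
    push_cast at hl hr
    simp only [add_lt_add_iff_left] at hl hr
    exact ⟨hr, hl⟩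
  · rintro ⟨han, hl, hr⟩
    rw [han]
    push_cast
    simp only [add_lt_add_iff_left]
    exact ⟨hr, hl⟩

lemma dependsOnDigits_indicator_cfInterval (l : List ℕ+) :
    DependsOnDigits l.length ((cfInterval l).indicator fun _ => (1 : ℝ)) := by
  induction l with
  | nil => exact ⟨1, fun x hx => by rw [cfInterval_nil, indicator_of_mem hx]⟩
  | cons a l ih =>
    intro n
    by_cases han : (a : ℕ) = n + 1
    · refine ih.congr fun y hy => ?_
      classical
      simp only [indicator_apply, cfBranch_mem_cfInterval_cons n a l hy, han, true_and]
    · refine (dependsOnDigits_const _ 0).congr fun y hy => ?_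
      classical
      simp only [indicator_apply, cfBranch_mem_cfInterval_cons n a l hy, han, false_and,
        if_false]

/-- Conditioning on a cf-ary interval: the law of `T^r x` given the first `r` digits. -/
theorem exists_cfLaw_cfInterval_inter (a : List ℕ+) {θ : ℝ} (hθ : θ ∈ Icc (0 : ℝ) 1) :
    ∃ θ' ∈ Icc (0 : ℝ) 1, ∀ S : Set ℝ, MeasurableSet S →
      cfLaw θ (cfInterval a ∩ gaussMap^[a.length] ⁻¹' S) = cfLaw θ (cfInterval a) * cfLaw θ' S := by
  induction a generalizing θ with
  | nil =>
    have := isProbabilityMeasure_cfLaw hθ.1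
    have key : ∀ S, MeasurableSet S → cfLaw θ (Ioo 0 1 ∩ S) = cfLaw θ S := fun S hS => by
      rw [cfLaw, withDensity_apply _ hS, withDensity_apply _ (measurableSet_Ioo.inter hS),
        Measure.restrict_restrict hS, Measure.restrict_restrict (measurableSet_Ioo.inter hS)]
      congr 2
      ext x
      simp only [mem_inter_iff]
      tauto
    refine ⟨θ, hθ, fun S hS => ?_⟩
    have h1 := key univ MeasurableSet.univ
    rw [inter_univ, measure_univ] at h1
    rw [cfInterval_nil, h1, one_mul]
    exact key S hS
  | cons d l ih =>
    obtain ⟨n, hn⟩ : ∃ n : ℕ, (d : ℕ) = n + 1 := ⟨d.natPred, d.natPred_add_one.symm⟩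
    -- `θ'` is the state reached by running the chain through the digits. It does not depend on `S`,
    -- so `S = univ` below evaluates the probability of the interval itself.
    obtain ⟨θ', hθ', h⟩ := ih (cfBranch_mem_Icc n hθ)
    refine ⟨θ', hθ', fun S hS => ?_⟩
    have key : ∀ S, MeasurableSet S →
        cfLaw θ (cfInterval (d :: l) ∩ gaussMap^[l.length + 1] ⁻¹' S) =
          ENNReal.ofReal (digitWeight n θ) *
            cfLaw (cfBranch n θ) (cfInterval l ∩ gaussMap^[l.length] ⁻¹' S) := by
      intro S hS
      have hm1 := (measurableSet_cfInterval (d :: l)).inter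
        (measurable_gaussMap.iterate (l.length + 1) hS)
      have hm2 := (measurableSet_cfInterval l).inter (measurable_gaussMap.iterate l.length hS)
      rw [← lintegral_indicator_one hm1, ← lintegral_indicator_one hm2,
        lintegral_cfLaw_eq_tsum hθ.1 (measurable_one.indicator hm1), tsum_eq_single n]
      · congr 1
        refine lintegral_cfLaw_congr _ fun y hy => ?_
        classical
        simp only [indicator_apply, mem_inter_iff, Pi.one_apply, mem_preimage,
          cfBranch_mem_cfInterval_cons n d l hy, hn, true_and,
          gaussMap_iterate_succ_cfBranch _ n hy]
      · intro n' hn'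
        rw [lintegral_cfLaw_congr _ (g := fun _ => 0), lintegral_zero, mul_zero]
        intro y hy
        rw [indicator_of_notMem]
        rintro ⟨h', -⟩
        have := ((cfBranch_mem_cfInterval_cons n' d l hy).1 h').1
        omega
    have huniv := key univ MeasurableSet.univ
    simp only [preimage_univ, inter_univ] at huniv
    rw [List.length_cons, key S hS, h S hS, huniv, mul_assoc]

/-! ### The transition operator and its contraction -/

lemma sum_range_digitWeight (n : ℕ) {θ : ℝ} (hθ : 0 ≤ θ) :
    ∑ i ∈ Finset.range n, digitWeight i θ = n / ((n : ℝ) + 1 + θ) := by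
  induction n with
  | zero => simp
  | succ n ih =>
    rw [Finset.sum_range_succ, ih, digitWeight]
    push_cast
    field_simp
    ring

lemma hasSum_digitWeight {θ : ℝ} (hθ : 0 ≤ θ) : HasSum (fun n => digitWeight n θ) 1 := by
  rw [hasSum_iff_tendsto_nat_of_nonneg fun n => digitWeight_nonneg n hθ]
  simp_rw [sum_range_digitWeight _ hθ, add_assoc]
  exact tendsto_natCast_div_add_atTop (1 + θ)

/-- The transfer operator of the chain `θ ↦ 1 / (d + θ)`. -/
noncomputable def digitOperator (f : ℝ → ℝ) (θ : ℝ) : ℝ :=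
  ∑' n : ℕ, digitWeight n θ * f (cfBranch n θ)

lemma summable_digitWeight_mul {f : ℝ → ℝ} (hf : ∀ θ ∈ Icc (0 : ℝ) 1, f θ ∈ Icc (0 : ℝ) 1)
    {θ : ℝ} (hθ : θ ∈ Icc (0 : ℝ) 1) :
    Summable fun n => digitWeight n θ * f (cfBranch n θ) := by
  refine Summable.of_nonneg_of_le (fun n => ?_) (fun n => ?_) (hasSum_digitWeight hθ.1).summable
  · exact mul_nonneg (digitWeight_nonneg n hθ.1) (hf _ (cfBranch_mem_Icc n hθ)).1
  · exact mul_le_of_le_one_right (digitWeight_nonneg n hθ.1) (hf _ (cfBranch_mem_Icc n hθ)).2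

lemma digitOperator_mem_Icc {f : ℝ → ℝ} (hf : ∀ θ ∈ Icc (0 : ℝ) 1, f θ ∈ Icc (0 : ℝ) 1)
    {θ : ℝ} (hθ : θ ∈ Icc (0 : ℝ) 1) : digitOperator f θ ∈ Icc (0 : ℝ) 1 := by
  refine ⟨tsum_nonneg fun n => ?_, ?_⟩
  · exact mul_nonneg (digitWeight_nonneg n hθ.1) (hf _ (cfBranch_mem_Icc n hθ)).1
  · rw [← (hasSum_digitWeight hθ.1).tsum_eq]
    exact (summable_digitWeight_mul hf hθ).tsum_le_tsum
      (fun n => mul_le_of_le_one_right (digitWeight_nonneg n hθ.1) (hf _ (cfBranch_mem_Icc n hθ)).2)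
      (hasSum_digitWeight hθ.1).summable

lemma digitOperator_sub {f g : ℝ → ℝ} (hf : ∀ θ ∈ Icc (0 : ℝ) 1, f θ ∈ Icc (0 : ℝ) 1)
    (hg : ∀ θ ∈ Icc (0 : ℝ) 1, g θ ∈ Icc (0 : ℝ) 1) {θ : ℝ} (hθ : θ ∈ Icc (0 : ℝ) 1) :
    digitOperator (fun t => f t - g t) θ = digitOperator f θ - digitOperator g θ := by
  simp only [digitOperator, mul_sub]
  exact (summable_digitWeight_mul hf hθ).tsum_sub (summable_digitWeight_mul hg hθ)

lemma digitOperator_one {θ : ℝ} (hθ : 0 ≤ θ) : digitOperator (fun _ => 1) θ = 1 := by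
  simp only [digitOperator, mul_one]
  exact (hasSum_digitWeight hθ).tsum_eq

/-- Abel summation inequality. -/
lemma sum_range_mul_le_of_antitone {b c : ℕ → ℝ} (hb : Antitone b)
    (hc : ∀ n, 0 ≤ ∑ i ∈ Finset.range n, c i) (n : ℕ) :
    (∑ i ∈ Finset.range n, c i) * b n ≤ ∑ i ∈ Finset.range n, c i * b i := by
  induction n with
  | zero => simp
  | succ n ih =>
    rw [Finset.sum_range_succ (fun i => c i * b i)]
    have h1 := mul_le_mul_of_nonneg_left (hb n.le_succ) (hc (n + 1))
    have h2 : (∑ i ∈ Finset.range (n + 1), c i) * b n =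
        (∑ i ∈ Finset.range n, c i) * b n + c n * b n := by
      rw [Finset.sum_range_succ, add_mul]
    linarith

lemma cfBranch_le_cfBranch (n : ℕ) {x y : ℝ} (hx : 0 ≤ x) (hxy : x ≤ y) :
    cfBranch n y ≤ cfBranch n x := by
  unfold cfBranch
  gcongr

lemma antitone_cfBranch {x : ℝ} (hx : 0 ≤ x) : Antitone fun n => cfBranch n x := by
  intro m n hmn
  simp only [cfBranch]
  gcongr

/-- Two effects push the same way as θ grows: each target 1/(n+1+θ) decreases, and mass moves to
larger digits, whose targets are smaller. The second follows by Abel summation, since the partial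
sums n/(n+1+θ) of the weights decrease in θ. -/
theorem antitoneOn_digitOperator {f : ℝ → ℝ} (hf : ∀ θ ∈ Icc (0 : ℝ) 1, f θ ∈ Icc (0 : ℝ) 1)
    (hmono : MonotoneOn f (Icc 0 1)) : AntitoneOn (digitOperator f) (Icc 0 1) := by
  intro x hx y hy hxy
  have hmid : Summable fun n => digitWeight n x * f (cfBranch n y) := by
    refine Summable.of_nonneg_of_le (fun n => ?_) (fun n => ?_) (hasSum_digitWeight hx.1).summable
    · exact mul_nonneg (digitWeight_nonneg n hx.1) (hf _ (cfBranch_mem_Icc n hy)).1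
    · exact mul_le_of_le_one_right (digitWeight_nonneg n hx.1) (hf _ (cfBranch_mem_Icc n hy)).2
  have h1 : ∑' n, digitWeight n x * f (cfBranch n y) ≤ digitOperator f x := by
    refine hmid.tsum_le_tsum (fun n => ?_) (summable_digitWeight_mul hf hx)
    exact mul_le_mul_of_nonneg_left (hmono (cfBranch_mem_Icc n hy) (cfBranch_mem_Icc n hx)
      (cfBranch_le_cfBranch n hx.1 hxy)) (digitWeight_nonneg n hx.1)
  refine le_trans ?_ h1
  rw [digitOperator, ← sub_nonneg, ← hmid.tsum_sub (summable_digitWeight_mul hf hy)]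
  refine ge_of_tendsto' (hmid.sub (summable_digitWeight_mul hf hy)).hasSum.tendsto_sum_nat
    fun n => ?_
  have hb : Antitone fun n => f (cfBranch n y) := fun m n hmn =>
    hmono (cfBranch_mem_Icc n hy) (cfBranch_mem_Icc m hy) (antitone_cfBranch hy.1 hmn)
  have hc : ∀ n, 0 ≤ ∑ i ∈ Finset.range n, (digitWeight i x - digitWeight i y) := by
    intro n
    have := hx.1
    rw [Finset.sum_sub_distrib, sum_range_digitWeight n hx.1, sum_range_digitWeight n hy.1,
      sub_nonneg]
    gcongr
  refine le_trans (mul_nonneg (hc n) (hf _ (cfBranch_mem_Icc n hy)).1)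
    ((sum_range_mul_le_of_antitone hb hc n).trans_eq ?_)
  simp only [sub_mul]

/-- The operator halves the oscillation of monotone functions. -/
theorem digitOperator_zero_sub_one_le {f : ℝ → ℝ} (hf : ∀ θ ∈ Icc (0 : ℝ) 1, f θ ∈ Icc (0 : ℝ) 1)
    (hmono : MonotoneOn f (Icc 0 1)) :
    digitOperator f 0 - digitOperator f 1 ≤ (f 1 - f 0) / 2 := by
  have h0 : (0 : ℝ) ∈ Icc (0 : ℝ) 1 := left_mem_Icc.2 zero_le_one
  have h1 : (1 : ℝ) ∈ Icc (0 : ℝ) 1 := right_mem_Icc.2 zero_le_one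
  have hs0 := summable_digitWeight_mul hf h0
  have hs1 := summable_digitWeight_mul hf h1
  have hw := (hasSum_digitWeight h1.1)
  -- Digit n+2 from θ = 0 and digit n+1 from θ = 1 lead to the same state 1/(n+2), the former with
  -- half the weight. The other half of the mass from θ = 0 goes to state 1.
  have e : ∀ n : ℕ, digitWeight (n + 1) 0 * f (cfBranch (n + 1) 0) =
      digitWeight n 1 * f (cfBranch n 1) / 2 := by
    intro n
    have : cfBranch (n + 1) 0 = cfBranch n 1 := by
      unfold cfBranch
      push_cast
      ring_nf
    rw [this, mul_div_right_comm]
    congr 1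
    unfold digitWeight
    push_cast
    field_simp
    ring
  have e0 : digitWeight 0 0 * f (cfBranch 0 0) = f 1 / 2 := by
    norm_num [digitWeight, cfBranch]
    ring
  have h2 : f 0 ≤ digitOperator f 1 := by
    have hf0 := hw.mul_right (f 0)
    rw [one_mul] at hf0
    rw [← hf0.tsum_eq]
    refine hf0.summable.tsum_le_tsum (fun n => ?_) hs1
    exact mul_le_mul_of_nonneg_left (hmono h0 (cfBranch_mem_Icc n h1) (cfBranch_mem_Icc n h1).1)
      (digitWeight_nonneg n h1.1)
  have h3 : digitOperator f 0 = f 1 / 2 + digitOperator f 1 / 2 := by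
    rw [digitOperator, hs0.tsum_eq_zero_add, e0]
    simp only [e, digitOperator, tsum_div_const]
  linarith

lemma digitOperator_one_sub {f : ℝ → ℝ} (hf : ∀ θ ∈ Icc (0 : ℝ) 1, f θ ∈ Icc (0 : ℝ) 1)
    {θ : ℝ} (hθ : θ ∈ Icc (0 : ℝ) 1) :
    digitOperator (fun t => 1 - f t) θ = 1 - digitOperator f θ := by
  rw [digitOperator_sub (fun _ _ => right_mem_Icc.2 zero_le_one) hf hθ, digitOperator_one hθ.1]

/-! ### Distribution functions and loss of memory -/

/-- The distribution function `x ↦ cfLaw θ (0, x)`. -/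
noncomputable def cfDistrib (x θ : ℝ) : ℝ := (1 + θ) * x / (1 + θ * x)

lemma cfDistrib_mem_Icc {x : ℝ} (hx : x ∈ Icc (0 : ℝ) 1) :
    ∀ θ ∈ Icc (0 : ℝ) 1, cfDistrib x θ ∈ Icc (0 : ℝ) 1 := by
  intro θ hθ
  have hx0 := hx.1
  have hθ0 := hθ.1
  refine ⟨by unfold cfDistrib; positivity, ?_⟩
  rw [cfDistrib, div_le_one (by positivity)]
  linarith [hx.2]

lemma monotoneOn_cfDistrib {x : ℝ} (hx : x ∈ Icc (0 : ℝ) 1) :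
    MonotoneOn (cfDistrib x) (Icc 0 1) := by
  intro s hs t ht hst
  have hx0 := hx.1
  have hs0 := hs.1
  have ht0 := ht.1
  unfold cfDistrib
  rw [div_le_div_iff₀ (by positivity) (by positivity)]
  nlinarith [mul_nonneg (mul_nonneg hx0 (sub_nonneg.2 hst)) (sub_nonneg.2 hx.2)]

lemma cfDistrib_one_sub_zero_le {x : ℝ} (hx : x ∈ Icc (0 : ℝ) 1) :
    cfDistrib x 1 - cfDistrib x 0 ≤ 1 / 4 := by
  have hx0 := hx.1
  have : cfDistrib x 1 - cfDistrib x 0 = x * (1 - x) / (1 + x) := by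
    unfold cfDistrib
    field_simp
    ring
  rw [this, div_le_iff₀ (by positivity)]
  nlinarith [sq_nonneg (8 * x - 3)]

lemma iterate_digitOperator_mem_Icc (m : ℕ) {x : ℝ} (hx : x ∈ Icc (0 : ℝ) 1) :
    ∀ θ ∈ Icc (0 : ℝ) 1, digitOperator^[m] (cfDistrib x) θ ∈ Icc (0 : ℝ) 1 := by
  induction m with
  | zero => exact cfDistrib_mem_Icc hx
  | succ m ih =>
    rw [Function.iterate_succ_apply']
    exact fun θ hθ => digitOperator_mem_Icc ih hθ

/-- The direction of monotonicity alternates with m but is the same for all x, which is why the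
disjunction stands outside the quantifier. A decreasing f is handled through 1 - f. -/
theorem iterate_digitOperator_cfDistrib (m : ℕ) :
    (∀ x ∈ Icc (0 : ℝ) 1, MonotoneOn (digitOperator^[m] (cfDistrib x)) (Icc 0 1) ∧
      digitOperator^[m] (cfDistrib x) 1 - digitOperator^[m] (cfDistrib x) 0 ≤ (1 / 2) ^ m / 4) ∨
    (∀ x ∈ Icc (0 : ℝ) 1, AntitoneOn (digitOperator^[m] (cfDistrib x)) (Icc 0 1) ∧
      digitOperator^[m] (cfDistrib x) 0 - digitOperator^[m] (cfDistrib x) 1 ≤ (1 / 2) ^ m / 4) := by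
  induction m with
  | zero => exact Or.inl fun x hx => ⟨monotoneOn_cfDistrib hx, by
      simpa using cfDistrib_one_sub_zero_le hx⟩
  | succ m ih =>
    simp only [Function.iterate_succ_apply']
    rcases ih with ih | ih
    · refine Or.inr fun x hx => ?_
      have hI := iterate_digitOperator_mem_Icc m hx
      refine ⟨antitoneOn_digitOperator hI (ih x hx).1, ?_⟩
      have := digitOperator_zero_sub_one_le hI (ih x hx).1
      rw [pow_succ]
      linarith [(ih x hx).2]
    · refine Or.inl fun x hx => ?_
      have hI := iterate_digitOperator_mem_Icc m hx
      have hI' : ∀ θ ∈ Icc (0 : ℝ) 1, 1 - digitOperator^[m] (cfDistrib x) θ ∈ Icc (0 : ℝ) 1 :=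
        fun θ hθ => ⟨by linarith [(hI θ hθ).2], by linarith [(hI θ hθ).1]⟩
      have hM : MonotoneOn (fun θ => 1 - digitOperator^[m] (cfDistrib x) θ) (Icc 0 1) :=
        fun s hs t ht hst => by linarith [(ih x hx).1 hs ht hst]
      constructor
      · intro s hs t ht hst
        have := antitoneOn_digitOperator hI' hM hs ht hst
        rw [digitOperator_one_sub hI hs, digitOperator_one_sub hI ht] at this
        linarith
      · have := digitOperator_zero_sub_one_le hI' hM
        rw [digitOperator_one_sub hI (left_mem_Icc.2 zero_le_one),
          digitOperator_one_sub hI (right_mem_Icc.2 zero_le_one)] at this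
        rw [pow_succ]
        linarith [(ih x hx).2]

/-- Both functions vary in the same direction, so their increments partly cancel and the bound is
one oscillation rather than two. -/
lemma iterate_digitOperator_sub_sub_le (m : ℕ) {x y s t : ℝ} (hx : x ∈ Icc (0 : ℝ) 1)
    (hy : y ∈ Icc (0 : ℝ) 1) (hs : s ∈ Icc (0 : ℝ) 1) (ht : t ∈ Icc (0 : ℝ) 1) :
    (digitOperator^[m] (cfDistrib y) s - digitOperator^[m] (cfDistrib x) s) -
      (digitOperator^[m] (cfDistrib y) t - digitOperator^[m] (cfDistrib x) t) ≤ (1 / 2) ^ m / 4 := by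
  have h0 : (0 : ℝ) ∈ Icc (0 : ℝ) 1 := left_mem_Icc.2 zero_le_one
  have h1 : (1 : ℝ) ∈ Icc (0 : ℝ) 1 := right_mem_Icc.2 zero_le_one
  rcases iterate_digitOperator_cfDistrib m with h | h
  all_goals
    obtain ⟨hxm, hxo⟩ := h x hx
    obtain ⟨hym, hyo⟩ := h y hy
    rcases le_total s t with hst | hst
    · linarith [hxm hs ht hst, hym hs ht hst, hxm h0 hs hs.1, hxm ht h1 ht.2, hym h0 hs hs.1,
        hym ht h1 ht.2]
    · linarith [hxm ht hs hst, hym ht hs hst, hxm h0 ht ht.1, hxm hs h1 hs.2, hym h0 ht ht.1,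
        hym hs h1 hs.2]

lemma cfLaw_real_iterate_preimage_succ (m : ℕ) {S : Set ℝ} (hS : MeasurableSet S) {θ : ℝ}
    (hθ : 0 ≤ θ) :
    (cfLaw θ).real (gaussMap^[m + 1] ⁻¹' S) =
      digitOperator (fun t => (cfLaw t).real (gaussMap^[m] ⁻¹' S)) θ := by
  have hm1 := measurable_gaussMap.iterate (m + 1) hS
  have hm2 := measurable_gaussMap.iterate m hS
  have hb : ∀ n, 0 ≤ cfBranch n θ := fun n => by unfold cfBranch; positivity
  have key : ∀ n, ∫⁻ y, (gaussMap^[m + 1] ⁻¹' S).indicator 1 (cfBranch n y) ∂cfLaw (cfBranch n θ) =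
      cfLaw (cfBranch n θ) (gaussMap^[m] ⁻¹' S) := by
    intro n
    rw [← lintegral_indicator_one hm2]
    refine lintegral_cfLaw_congr _ fun y hy => ?_
    classical
    simp only [indicator_apply, mem_preimage, Pi.one_apply, gaussMap_iterate_succ_cfBranch _ n hy]
  rw [measureReal_def, ← lintegral_indicator_one hm1,
    lintegral_cfLaw_eq_tsum hθ (measurable_one.indicator hm1), ENNReal.tsum_toReal_eq]
  · refine tsum_congr fun n => ?_
    rw [key, ENNReal.toReal_mul, ENNReal.toReal_ofReal (digitWeight_nonneg n hθ)]
    rfl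
  · intro n
    have := isProbabilityMeasure_cfLaw (hb n)
    rw [key]
    exact ENNReal.mul_ne_top ENNReal.ofReal_ne_top (measure_ne_top _ _)

lemma cfLaw_real_iterate_preimage_Ioo (m : ℕ) {x y : ℝ} (hx : x ∈ Icc (0 : ℝ) 1)
    (hy : y ∈ Icc (0 : ℝ) 1) (hxy : x ≤ y) {θ : ℝ} (hθ : θ ∈ Icc (0 : ℝ) 1) :
    (cfLaw θ).real (gaussMap^[m] ⁻¹' Ioo x y) =
      digitOperator^[m] (cfDistrib y) θ - digitOperator^[m] (cfDistrib x) θ := by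
  induction m generalizing θ with
  | zero =>
    rw [Function.iterate_zero, preimage_id, measureReal_def,
      cfLaw_Ioo hθ.1 hx.1 hxy hy.2, ENNReal.toReal_ofReal]
    · rfl
    · have h1 := hθ.1
      have h2 := hx.1
      have h3 := hy.1
      rw [sub_nonneg, div_le_div_iff₀ (by positivity) (by positivity)]
      nlinarith [mul_nonneg (sub_nonneg.2 hxy) (by positivity : 0 ≤ 1 + θ)]
  | succ m ih =>
    rw [cfLaw_real_iterate_preimage_succ m measurableSet_Ioo hθ.1, Function.iterate_succ_apply',
      Function.iterate_succ_apply', ← digitOperator_sub (iterate_digitOperator_mem_Icc m hy)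
      (iterate_digitOperator_mem_Icc m hx) hθ]
    refine tsum_congr fun n => ?_
    simp only
    rw [ih (cfBranch_mem_Icc n hθ)]

/-- Exponential forgetting of the initial condition. -/
theorem cfLaw_real_iterate_preimage_sub_le (m : ℕ) (b : List ℕ+) {s t : ℝ}
    (hs : s ∈ Icc (0 : ℝ) 1) (ht : t ∈ Icc (0 : ℝ) 1) :
    (cfLaw s).real (gaussMap^[m] ⁻¹' cfInterval b) - (cfLaw t).real (gaussMap^[m] ⁻¹' cfInterval b)
      ≤ (1 / 2) ^ m / 4 := by
  have h0 := cfEval_mem_Icc b (left_mem_Icc.2 zero_le_one)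
  have h1 := cfEval_mem_Icc b (right_mem_Icc.2 zero_le_one)
  have hx : min (cfEval b 0) (cfEval b 1) ∈ Icc (0 : ℝ) 1 :=
    ⟨le_min h0.1 h1.1, (min_le_left _ _).trans h0.2⟩
  have hy : max (cfEval b 0) (cfEval b 1) ∈ Icc (0 : ℝ) 1 :=
    ⟨h0.1.trans (le_max_left _ _), max_le h0.2 h1.2⟩
  rw [cfInterval, cfLaw_real_iterate_preimage_Ioo m hx hy min_le_max hs,
    cfLaw_real_iterate_preimage_Ioo m hx hy min_le_max ht]
  exact iterate_digitOperator_sub_sub_le m hx hy hs ht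

/-! ### The Gauss measure: invariance, mixture, mixing -/

lemma measurable_cfDensity_uncurry : Measurable (Function.uncurry cfDensity) := by
  unfold cfDensity Function.uncurry
  fun_prop

lemma lintegral_gaussMeasure {f : ℝ → ℝ≥0∞} (hf : Measurable f) :
    ∫⁻ x, f x ∂gaussMeasure =
      ∫⁻ x in Ioo 0 1, ENNReal.ofReal (1 / ((1 + x) * Real.log 2)) * f x := by
  rw [gaussMeasure, lintegral_withDensity_eq_lintegral_mul _ (by fun_prop) hf]
  rfl

instance isProbabilityMeasure_gaussMeasure : IsProbabilityMeasure gaussMeasure := by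
  have hlog : 0 < Real.log 2 := Real.log_pos one_lt_two
  have hcont : ContinuousOn (fun x : ℝ => 1 / ((1 + x) * Real.log 2)) (Icc 0 1) := by
    refine ContinuousOn.div (by fun_prop) (by fun_prop) fun x hx => ?_
    have := hx.1
    positivity
  constructor
  rw [gaussMeasure, withDensity_apply _ MeasurableSet.univ, Measure.restrict_univ,
    setLIntegral_congr Ioo_ae_eq_Ioc, ← ofReal_integral_eq_lintegral_ofReal,
    ← intervalIntegral.integral_of_le zero_le_one,
    intervalIntegral.integral_eq_sub_of_hasDerivAt (f := fun x => Real.log (1 + x) / Real.log 2)]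
  · norm_num
  · intro x hx
    rw [uIcc_of_le zero_le_one] at hx
    have hx0 : 1 + x ≠ 0 := by linarith [hx.1]
    have := (((hasDerivAt_id x).const_add 1).log hx0).div_const (Real.log 2)
    rwa [div_div] at this
  · rw [← uIcc_of_le (zero_le_one' ℝ)] at hcont
    exact hcont.intervalIntegrable
  · exact hcont.integrableOn_Icc.mono_set Ioc_subset_Icc_self
  · filter_upwards [ae_restrict_mem measurableSet_Ioc] with x hx
    have := hx.1
    show 0 ≤ 1 / ((1 + x) * Real.log 2)
    positivity

/-- Pulled back along branch n, the Gauss density at y is multiplied by `digitWeight n y`, and these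
weights sum to 1. -/
theorem measurePreserving_gaussMap : MeasurePreserving gaussMap gaussMeasure gaussMeasure := by
  refine ⟨measurable_gaussMap, Measure.ext fun S hS => ?_⟩
  have hS' := measurable_gaussMap hS
  have hlog : 0 < Real.log 2 := Real.log_pos one_lt_two
  rw [Measure.map_apply measurable_gaussMap hS, ← lintegral_indicator_one hS',
    ← lintegral_indicator_one hS, lintegral_gaussMeasure (measurable_one.indicator hS'),
    lintegral_gaussMeasure (measurable_one.indicator hS), lintegral_Ioo_eq_tsum_cfBranch]
  have hterm : ∀ n : ℕ, ∫⁻ y in Ioo 0 1, ENNReal.ofReal (1 / ((n : ℝ) + 1 + y) ^ 2) *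
        (ENNReal.ofReal (1 / ((1 + cfBranch n y) * Real.log 2)) *
          (gaussMap ⁻¹' S).indicator 1 (cfBranch n y)) =
      ∫⁻ y in Ioo 0 1, ENNReal.ofReal (digitWeight n y) *
        (ENNReal.ofReal (1 / ((1 + y) * Real.log 2)) * S.indicator 1 y) := by
    intro n
    refine setLIntegral_congr_fun measurableSet_Ioo fun y hy => ?_
    have hy0 := hy.1
    have hind : (gaussMap ⁻¹' S).indicator (1 : ℝ → ℝ≥0∞) (cfBranch n y) = S.indicator 1 y := by
      classical
      simp only [indicator_apply, mem_preimage, Pi.one_apply, gaussMap_cfBranch n hy]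
    rw [hind, ← mul_assoc, ← mul_assoc, ← ENNReal.ofReal_mul (by positivity),
      ← ENNReal.ofReal_mul (digitWeight_nonneg n hy0.le)]
    congr 2
    unfold cfBranch digitWeight
    field_simp
    ring
  rw [tsum_congr hterm, ← lintegral_tsum]
  · refine setLIntegral_congr_fun measurableSet_Ioo fun y hy => ?_
    rw [ENNReal.tsum_mul_right, ← ENNReal.ofReal_tsum_of_nonneg
      (fun n => digitWeight_nonneg n hy.1.le) (hasSum_digitWeight hy.1.le).summable,
      (hasSum_digitWeight hy.1.le).tsum_eq, ENNReal.ofReal_one, one_mul]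
  · intro n
    refine Measurable.aemeasurable ?_
    have : Measurable (S.indicator (1 : ℝ → ℝ≥0∞)) := measurable_one.indicator hS
    unfold digitWeight
    fun_prop

/-- The Gauss measure is the mixture of the laws `cfLaw θ` with `θ` itself Gauss distributed. -/
theorem gaussMeasure_eq_lintegral_cfLaw {S : Set ℝ} (hS : MeasurableSet S) :
    gaussMeasure S = ∫⁻ θ, cfLaw θ S ∂gaussMeasure := by
  have hlog : 0 < Real.log 2 := Real.log_pos one_lt_two
  have hind : Measurable (S.indicator (1 : ℝ → ℝ≥0∞)) := measurable_one.indicator hS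
  have hlaw : ∀ θ, cfLaw θ S = ∫⁻ x in Ioo 0 1, ENNReal.ofReal (cfDensity θ x) * S.indicator 1 x :=
    fun θ => by rw [← lintegral_indicator_one hS, lintegral_cfLaw θ hind]
  have hmeas : Measurable fun z : ℝ × ℝ => ENNReal.ofReal (cfDensity z.1 z.2) * S.indicator 1 z.2 :=
    measurable_cfDensity_uncurry.ennreal_ofReal.mul (hind.comp measurable_snd)
  have hmeas' : Measurable fun z : ℝ × ℝ => ENNReal.ofReal (1 / ((1 + z.1) * Real.log 2)) *
      (ENNReal.ofReal (cfDensity z.1 z.2) * S.indicator 1 z.2) :=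
    Measurable.mul (by fun_prop) hmeas
  simp only [hlaw]
  rw [lintegral_gaussMeasure hmeas.lintegral_prod_right', ← lintegral_indicator_one hS,
    lintegral_gaussMeasure hind]
  simp_rw [← lintegral_const_mul' _ _ ENNReal.ofReal_ne_top]
  rw [lintegral_lintegral_swap hmeas'.aemeasurable]
  refine setLIntegral_congr_fun measurableSet_Ioo fun x hx => ?_
  have hx0 := hx.1
  -- The joint density 1/((1+θx)² log 2) is symmetric in θ and x, so integrating out θ gives back
  -- the Gauss density times the total mass 1 of `cfLaw x`.
  have hsymm : ∫⁻ θ in Ioo 0 1, ENNReal.ofReal (1 / ((1 + θ) * Real.log 2)) *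
        (ENNReal.ofReal (cfDensity θ x) * S.indicator 1 x) =
      ∫⁻ θ in Ioo 0 1, ENNReal.ofReal (cfDensity x θ) *
        (ENNReal.ofReal (1 / ((1 + x) * Real.log 2)) * S.indicator 1 x) := by
    refine setLIntegral_congr_fun measurableSet_Ioo fun θ hθ => ?_
    have hθ0 := hθ.1
    rw [← mul_assoc, ← mul_assoc, ← ENNReal.ofReal_mul (by positivity),
      ← ENNReal.ofReal_mul (by unfold cfDensity; positivity)]
    congr 2
    unfold cfDensity
    field_simp
  rw [hsymm, lintegral_mul_const _ (measurable_cfDensity x).ennreal_ofReal,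
    lintegral_Ioo_cfDensity hx0.le le_rfl zero_le_one]
  have : 1 + x ≠ 0 := by positivity
  simp [this]

/-- Mixing with exponential rate. -/
theorem abs_cfLaw_real_sub_gaussMeasure_real_le (m : ℕ) (b : List ℕ+) {θ : ℝ}
    (hθ : θ ∈ Icc (0 : ℝ) 1) :
    |(cfLaw θ).real (gaussMap^[m] ⁻¹' cfInterval b) - gaussMeasure.real (cfInterval b)| ≤
      (1 / 2) ^ m / 4 := by
  have hm := measurable_gaussMap.iterate m (measurableSet_cfInterval b)
  set S := gaussMap^[m] ⁻¹' cfInterval b with hS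
  -- By invariance and the mixture formula, μ(I_b) is an average of the probabilities `cfLaw t S`,
  -- all within 2^{-m}/4 of each other.
  have hμ : gaussMeasure (cfInterval b) = ∫⁻ t, cfLaw t S ∂gaussMeasure := by
    rw [← (measurePreserving_gaussMap.iterate m).measure_preimage
      (measurableSet_cfInterval b).nullMeasurableSet, ← hS, ← gaussMeasure_eq_lintegral_cfLaw hm]
  have hae : ∀ᵐ t ∂gaussMeasure, t ∈ Icc (0 : ℝ) 1 := by
    apply (withDensity_absolutelyContinuous _ _).ae_le
    filter_upwards [ae_restrict_mem measurableSet_Ioo] with x hx using Ioo_subset_Icc_self hx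
  have hup : gaussMeasure (cfInterval b) ≤ ENNReal.ofReal ((cfLaw θ).real S + (1 / 2) ^ m / 4) := by
    rw [hμ, ← mul_one (ENNReal.ofReal _), ← measure_univ (μ := gaussMeasure), ← lintegral_const]
    refine lintegral_mono_ae ?_
    filter_upwards [hae] with t ht
    have := isProbabilityMeasure_cfLaw ht.1
    rw [← ofReal_measureReal]
    exact ENNReal.ofReal_le_ofReal (by
      linarith [cfLaw_real_iterate_preimage_sub_le m b ht hθ])
  have hlo : ENNReal.ofReal ((cfLaw θ).real S - (1 / 2) ^ m / 4) ≤ gaussMeasure (cfInterval b) := by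
    rw [hμ, ← mul_one (ENNReal.ofReal _), ← measure_univ (μ := gaussMeasure), ← lintegral_const]
    refine lintegral_mono_ae ?_
    filter_upwards [hae] with t ht
    have := isProbabilityMeasure_cfLaw ht.1
    rw [← ofReal_measureReal]
    exact ENNReal.ofReal_le_ofReal (by
      linarith [cfLaw_real_iterate_preimage_sub_le m b hθ ht])
  rw [← ofReal_measureReal] at hup hlo
  rw [ENNReal.ofReal_le_ofReal_iff (by positivity)] at hup
  rw [ENNReal.ofReal_le_ofReal_iff measureReal_nonneg] at hlo
  rw [abs_le]
  constructor <;> linarith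

/-! ### Exponential moments and the Chernoff bound -/

/-- The occurrence of the block `b` at the start of `x`, centred. -/
noncomputable def centredIndicator (b : List ℕ+) (x : ℝ) : ℝ :=
  (cfInterval b).indicator (fun _ => (1 : ℝ)) x - gaussMeasure.real (cfInterval b)

lemma measurable_centredIndicator (b : List ℕ+) : Measurable (centredIndicator b) :=
  (measurable_const.indicator (measurableSet_cfInterval b)).sub_const _

/-- Hoeffding's lemma about the true mean under `cfLaw θ` gives s²/8; recentring at μ(I_b) costs |s|
times the mixing error. -/
lemma lintegral_exp_centredIndicator_le (m : ℕ) (b : List ℕ+) (s : ℝ) {θ : ℝ}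
    (hθ : θ ∈ Icc (0 : ℝ) 1) :
    ∫⁻ x, ENNReal.ofReal (Real.exp (s * centredIndicator b (gaussMap^[m] x))) ∂cfLaw θ ≤
      ENNReal.ofReal (Real.exp (s ^ 2 / 8 + |s| * ((1 / 2) ^ m / 4))) := by
  have := isProbabilityMeasure_cfLaw hθ.1
  set S := gaussMap^[m] ⁻¹' cfInterval b with hS
  have hm : MeasurableSet S := measurable_gaussMap.iterate m (measurableSet_cfInterval b)
  set X : ℝ → ℝ := S.indicator fun _ => (1 : ℝ) with hX
  have hXm : Measurable X := measurable_const.indicator hm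
  have hXI : ∀ᵐ x ∂cfLaw θ, X x ∈ Icc (0 : ℝ) 1 := by
    filter_upwards with x
    by_cases h : x ∈ S <;> simp [hX, h]
  have hsub := ProbabilityTheory.hasSubgaussianMGF_of_mem_Icc hXm.aemeasurable hXI
  have hint : ∫ x, X x ∂cfLaw θ = (cfLaw θ).real S := by
    rw [hX, integral_indicator_const _ hm, smul_eq_mul, mul_one]
  rw [hint] at hsub
  have hmgf := hsub.mgf_le s
  have hexp := (hsub.integrable_exp_mul s).const_mul
    (Real.exp (s * ((cfLaw θ).real S - gaussMeasure.real (cfInterval b))))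
  have hc : ∀ x, s * centredIndicator b (gaussMap^[m] x) =
      s * ((cfLaw θ).real S - gaussMeasure.real (cfInterval b)) + s * (X x - (cfLaw θ).real S) := by
    intro x
    have : (cfInterval b).indicator (fun _ => (1 : ℝ)) (gaussMap^[m] x) = X x := rfl
    rw [centredIndicator, this]
    ring
  simp only [hc, Real.exp_add]
  rw [← ofReal_integral_eq_lintegral_ofReal hexp (ae_of_all _ fun x => by positivity),
    integral_const_mul, ← Real.exp_add, add_comm (s ^ 2 / 8), Real.exp_add]
  refine ENNReal.ofReal_le_ofReal (mul_le_mul ?_ (hmgf.trans_eq ?_) (by positivity) (by positivity))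
  · rw [Real.exp_le_exp]
    refine (le_abs_self _).trans ?_
    rw [abs_mul]
    gcongr
    exact abs_cfLaw_real_sub_gaussMeasure_real_le m b hθ
  · congr 1
    norm_num
    ring

/-- One step of the exponential martingale bound. -/
lemma lintegral_prod_exp_succ_le (b : List ℕ+) (s : ℝ) (m N : ℕ) {C : ℝ≥0∞}
    (hC : ∀ θ ∈ Icc (0 : ℝ) 1, ∫⁻ x, ∏ t ∈ Finset.range N, ENNReal.ofReal
      (Real.exp (s * centredIndicator b (gaussMap^[m + t * (m + b.length)] x))) ∂cfLaw θ ≤ C)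
    (j : ℕ) {θ : ℝ} (hθ : θ ∈ Icc (0 : ℝ) 1) :
    ∫⁻ x, ∏ t ∈ Finset.range (N + 1), ENNReal.ofReal
      (Real.exp (s * centredIndicator b (gaussMap^[j + t * (m + b.length)] x))) ∂cfLaw θ ≤
      ENNReal.ofReal (Real.exp (s ^ 2 / 8 + |s| * ((1 / 2) ^ j / 4))) * C := by
  have hgm : Measurable fun x => ENNReal.ofReal (Real.exp (s * centredIndicator b x)) :=
    ((measurable_centredIndicator b).const_mul s).exp.ennreal_ofReal
  have hdep : DependsOnDigits (j + b.length) fun x =>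
      ENNReal.ofReal (Real.exp (s * centredIndicator b (gaussMap^[j] x))) :=
    ((dependsOnDigits_indicator_cfInterval b).map fun u =>
      ENNReal.ofReal (Real.exp (s * (u - gaussMeasure.real (cfInterval b))))).comp_gaussMap_iterate j
  have hGm : Measurable fun x => ∏ t ∈ Finset.range N, ENNReal.ofReal
      (Real.exp (s * centredIndicator b (gaussMap^[m + t * (m + b.length)] x))) :=
    Finset.measurable_prod _ fun t _ => hgm.comp (measurable_gaussMap.iterate _)
  refine le_trans (le_of_eq ?_) ((hdep.lintegral_mul_le (hgm.comp (measurable_gaussMap.iterate j))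
    hGm hC hθ).trans ?_)
  · refine lintegral_congr fun x => ?_
    -- The factor t = 0 reads only the first j + k digits, where k is the length of `b`. Later
    -- positions are j + (t+1)(m+k) = (m + t(m+k)) + (j+k), so their product is a function of
    -- T^{j+k} x.
    rw [Finset.prod_range_succ', mul_comm, zero_mul, add_zero]
    congr 1
    refine Finset.prod_congr rfl fun t _ => ?_
    rw [← Function.iterate_add_apply]
    congr 5
    ring
  · gcongr
    exact lintegral_exp_centredIndicator_le j b s hθ

lemma lintegral_prod_exp_le (b : List ℕ+) (s : ℝ) (m N : ℕ) {θ : ℝ} (hθ : θ ∈ Icc (0 : ℝ) 1) :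
    ∫⁻ x, ∏ t ∈ Finset.range N, ENNReal.ofReal
      (Real.exp (s * centredIndicator b (gaussMap^[m + t * (m + b.length)] x))) ∂cfLaw θ ≤
      ENNReal.ofReal (Real.exp (N * (s ^ 2 / 8 + |s| * ((1 / 2) ^ m / 4)))) := by
  induction N generalizing θ with
  | zero =>
    have := isProbabilityMeasure_cfLaw hθ.1
    simp
  | succ N ih =>
    refine (lintegral_prod_exp_succ_le b s m N (fun θ hθ => ih hθ) m hθ).trans_eq ?_
    rw [← ENNReal.ofReal_mul (by positivity), ← Real.exp_add]
    congr 2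
    push_cast
    ring

/-- Large deviations along an arithmetic progression of positions, one-sided. -/
lemma cfLaw_one_sided_le (b : List ℕ+) {δ : ℝ} (hδ : 0 < δ) (m j N : ℕ)
    (hm : (1 / 2 : ℝ) ^ m ≤ 2 * δ) {s : ℝ} (hs : |s| = 2 * δ) {θ : ℝ} (hθ : θ ∈ Icc (0 : ℝ) 1) :
    cfLaw θ {x | 2 * δ * (((N + 1 : ℕ) : ℝ) * δ) ≤
        s * ∑ t ∈ Finset.range (N + 1), centredIndicator b (gaussMap^[j + t * (m + b.length)] x)} ≤
      ENNReal.ofReal (Real.exp (-(δ ^ 2 * ((N + 1 : ℕ) : ℝ) / 2) + 1 / 16)) := by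
  have hgm : Measurable fun x => ENNReal.ofReal (Real.exp (s * centredIndicator b x)) :=
    ((measurable_centredIndicator b).const_mul s).exp.ennreal_ofReal
  have hset : {x | 2 * δ * (((N + 1 : ℕ) : ℝ) * δ) ≤
        s * ∑ t ∈ Finset.range (N + 1), centredIndicator b (gaussMap^[j + t * (m + b.length)] x)} =
      {x | ENNReal.ofReal (Real.exp (2 * δ * (((N + 1 : ℕ) : ℝ) * δ))) ≤
        ∏ t ∈ Finset.range (N + 1), ENNReal.ofReal
          (Real.exp (s * centredIndicator b (gaussMap^[j + t * (m + b.length)] x)))} := by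
    ext x
    rw [mem_ofPred_eq, mem_ofPred_eq, ← ENNReal.ofReal_prod_of_nonneg fun t _ => (Real.exp_pos _).le,
      ← Real.exp_sum, ENNReal.ofReal_le_ofReal_iff (Real.exp_pos _).le, Real.exp_le_exp,
      Finset.mul_sum]
  rw [hset]
  refine (meas_ge_le_lintegral_div (Finset.measurable_prod _ fun t _ =>
    hgm.comp (measurable_gaussMap.iterate _)).aemeasurable
    (by simp [Real.exp_pos]) ENNReal.ofReal_ne_top).trans ?_
  refine (ENNReal.div_le_div_right (lintegral_prod_exp_succ_le b s m N
    (fun θ hθ => lintegral_prod_exp_le b s m N hθ) j hθ) _).trans ?_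
  rw [← ENNReal.ofReal_mul (by positivity), ← ENNReal.ofReal_div_of_pos (Real.exp_pos _),
    ← Real.exp_add, ← Real.exp_sub]
  refine ENNReal.ofReal_le_ofReal (Real.exp_le_exp.2 ?_)
  have hs2 : s ^ 2 = 4 * δ ^ 2 := by
    rw [← sq_abs, hs]
    ring
  have hj : (1 / 2 : ℝ) ^ j ≤ 1 := pow_le_one₀ (by norm_num) (by norm_num)
  rw [hs2, hs]
  push_cast
  -- The first block has only j digits before it, so its bias is bounded crudely by δ/2. Every later
  -- one costs at most δ²/2 + δ², against the gain 2δ², a net -δ²/2. The excess is δ/2 - δ² = 1/16 -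
  -- (δ - 1/4)².
  have h1 : 2 * δ * ((1 / 2 : ℝ) ^ j / 4) ≤ δ / 2 := by nlinarith
  have h2 : (N : ℝ) * (4 * δ ^ 2 / 8 + 2 * δ * ((1 / 2) ^ m / 4)) ≤ N * (4 * δ ^ 2 / 8 + δ ^ 2) := by
    gcongr
    nlinarith
  nlinarith [sq_nonneg (δ - 1 / 4)]

lemma cfLaw_real_two_sided_le (b : List ℕ+) {δ : ℝ} (hδ : 0 < δ) (m j N : ℕ)
    (hm : (1 / 2 : ℝ) ^ m ≤ 2 * δ) {θ : ℝ} (hθ : θ ∈ Icc (0 : ℝ) 1) :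
    (cfLaw θ).real {x | (N : ℝ) * δ <
        |∑ t ∈ Finset.range N, centredIndicator b (gaussMap^[j + t * (m + b.length)] x)|} ≤
      2 * Real.exp (-(δ ^ 2 * (N : ℝ) / 2) + 1 / 16) := by
  have := isProbabilityMeasure_cfLaw hθ.1
  rcases N with _ | N
  · simp
    positivity
  have key : ∀ s : ℝ, |s| = 2 * δ → (cfLaw θ).real {x | 2 * δ * (((N + 1 : ℕ) : ℝ) * δ) ≤
        s * ∑ t ∈ Finset.range (N + 1), centredIndicator b (gaussMap^[j + t * (m + b.length)] x)} ≤
      Real.exp (-(δ ^ 2 * ((N + 1 : ℕ) : ℝ) / 2) + 1 / 16) := fun s hs =>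
    ENNReal.toReal_le_of_le_ofReal (by positivity) (cfLaw_one_sided_le b hδ m j N hm hs hθ)
  have h1 := key (2 * δ) (abs_of_pos (by positivity))
  have h2 := key (-(2 * δ)) (by rw [abs_neg, abs_of_pos (by positivity)])
  refine (measureReal_mono ?_ (measure_ne_top _ _)).trans
    ((measureReal_union_le _ _).trans ((add_le_add h1 h2).trans_eq (two_mul _).symm))
  intro x hx
  rcases lt_abs.1 (mem_ofPred_eq ▸ hx) with h | h
  · exact Or.inl (mul_le_mul_of_nonneg_left h.le (by positivity))
  · refine Or.inr ?_
    rw [mem_ofPred_eq, neg_mul, ← mul_neg]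
    exact mul_le_mul_of_nonneg_left h.le (by positivity)

/-! ### Residue classes and the union bound -/

/-- Splitting `range n` into residue classes modulo `K`. -/
lemma sum_range_eq_sum_residue {K : ℕ} (hK : 0 < K) (n : ℕ) (c : ℕ → ℝ) :
    ∑ i ∈ Finset.range n, c i =
      ∑ j ∈ Finset.range K, ∑ t ∈ Finset.range ((n + K - 1 - j) / K), c (j + t * K) := by
  rw [Finset.sum_sigma']
  refine Finset.sum_nbij' (fun i => ⟨i % K, i / K⟩) (fun z => z.1 + z.2 * K) ?_ ?_ ?_ ?_ ?_
  · intro i hi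
    have h1 := Nat.mod_lt i hK
    have h2 := Nat.mod_add_div' i K
    simp only [Finset.mem_sigma, Finset.mem_range] at hi ⊢
    refine ⟨h1, ?_⟩
    rw [← Nat.succ_le_iff, Nat.le_div_iff_mul_le hK, Nat.succ_mul]
    omega
  · rintro ⟨j, t⟩ hz
    simp only [Finset.mem_sigma, Finset.mem_range] at hz ⊢
    obtain ⟨hj, ht⟩ := hz
    rw [← Nat.succ_le_iff, Nat.le_div_iff_mul_le hK, Nat.succ_mul] at ht
    omega
  · intro i _
    exact Nat.mod_add_div' i K
  · rintro ⟨j, t⟩ hz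
    simp only [Finset.mem_sigma, Finset.mem_range] at hz
    simp [Nat.add_mul_div_right _ _ hK, Nat.mod_eq_of_lt hz.1, Nat.div_eq_of_lt hz.1]
  · intro i _
    exact congrArg c (Nat.mod_add_div' i K).symm

lemma le_residue_card {K : ℕ} (hK : 0 < K) (n : ℕ) {j : ℕ} (hj : j < K) :
    (n : ℝ) / K - 1 ≤ ((n + K - 1 - j) / K : ℕ) := by
  have h := Nat.lt_div_mul_add (a := n + K - 1 - j) hK
  have h' : n ≤ ((n + K - 1 - j) / K) * K + K := by omega
  have hK' : (0 : ℝ) < K := by exact_mod_cast hK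
  rw [sub_le_iff_le_add, div_le_iff₀ hK', add_mul, one_mul]
  exact_mod_cast h'

/-- Large deviations for the block frequency under the conditional laws. -/
theorem cfLaw_real_deviation_le (b : List ℕ+) {δ : ℝ} (hδ : 0 < δ) (hδ1 : δ < 1) {n : ℕ}
    (hn : 0 < n) (m : ℕ) (hK : 0 < m + b.length) (hm : (1 / 2 : ℝ) ^ m ≤ 2 * δ) {θ : ℝ}
    (hθ : θ ∈ Icc (0 : ℝ) 1) :
    (cfLaw θ).real {x | |cfBlockFreq b 0 n x - gaussMeasure.real (cfInterval b)| > δ} ≤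
      6 * ((m + b.length : ℕ) : ℝ) *
        Real.exp (-(δ ^ 2 * (n : ℝ)) / (2 * ((m + b.length : ℕ) : ℝ))) := by
  have := isProbabilityMeasure_cfLaw hθ.1
  set K := m + b.length with hKdef
  have hK' : (0 : ℝ) < K := by exact_mod_cast hK
  have hn' : (0 : ℝ) < n := by exact_mod_cast hn
  set N : ℕ → ℕ := fun j => (n + K - 1 - j) / K with hN
  set E : ℕ → Set ℝ := fun j => {x | (N j : ℝ) * δ <
    |∑ t ∈ Finset.range (N j), centredIndicator b (gaussMap^[j + t * K] x)|} with hE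
  have hNsum : (n : ℝ) = ∑ j ∈ Finset.range K, (N j : ℝ) := by
    simpa using sum_range_eq_sum_residue hK n fun _ => 1
  -- Since the class sizes add up to n, a total deviation above nδ forces some class to deviate by
  -- more than δ times its size.
  have hsub : {x | |cfBlockFreq b 0 n x - gaussMeasure.real (cfInterval b)| > δ} ⊆
      ⋃ j ∈ Finset.range K, E j := by
    intro x hx
    by_contra hnot
    simp only [hE, mem_iUnion, mem_ofPred_eq, not_exists, not_lt] at hnot
    have hfreq : cfBlockFreq b 0 n x - gaussMeasure.real (cfInterval b) =
        (1 / (n : ℝ)) * ∑ i ∈ Finset.range n, centredIndicator b (gaussMap^[i] x) := by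
      simp only [cfBlockFreq, centredIndicator, zero_add, Finset.sum_sub_distrib, Finset.sum_const,
        Finset.card_range, nsmul_eq_mul]
      field_simp
    rw [mem_ofPred_eq, hfreq, sum_range_eq_sum_residue hK n, abs_mul,
      abs_of_pos (by positivity : 0 < 1 / (n : ℝ)), gt_iff_lt, one_div, ← div_eq_inv_mul,
      lt_div_iff₀ hn'] at hx
    refine hx.not_ge ((Finset.abs_sum_le_sum_abs _ _).trans ?_)
    rw [hNsum, Finset.mul_sum]
    refine Finset.sum_le_sum fun j hj => ?_
    rw [mul_comm]
    exact hnot j hj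
  have hbound : ∀ j ∈ Finset.range K, (cfLaw θ).real (E j) ≤
      6 * Real.exp (-(δ ^ 2 * (n : ℝ)) / (2 * (K : ℝ))) := by
    intro j hj
    refine (cfLaw_real_two_sided_le b hδ m j (N j) hm hθ).trans ?_
    have hcard := le_residue_card hK n (Finset.mem_range.1 hj)
    -- Replacing N j by n/K costs at most δ²/2 ≤ 1/2, and 1/2 + 1/16 ≤ 1; then 2e ≤ 6 gives the
    -- constant.
    have hle : -(δ ^ 2 * (N j : ℝ) / 2) + 1 / 16 ≤ 1 + -(δ ^ 2 * (n : ℝ)) / (2 * (K : ℝ)) := by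
      have e : -(δ ^ 2 * (n : ℝ)) / (2 * (K : ℝ)) = -(δ ^ 2 * ((n : ℝ) / K) / 2) := by
        field_simp
      have h1 := mul_le_mul_of_nonneg_left hcard (sq_nonneg δ)
      have h2 : δ ^ 2 ≤ 1 := pow_le_one₀ hδ.le hδ1.le
      rw [e]
      linarith
    have he : Real.exp 1 ≤ 3 := by linarith [Real.exp_one_lt_d9]
    have h3 := Real.exp_le_exp.2 hle
    rw [Real.exp_add 1] at h3
    have h4 := mul_le_mul_of_nonneg_right he
      (Real.exp_pos (-(δ ^ 2 * (n : ℝ)) / (2 * (K : ℝ)))).le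
    linarith
  calc _ ≤ (cfLaw θ).real (⋃ j ∈ Finset.range K, E j) := measureReal_mono hsub (measure_ne_top _ _)
    _ ≤ ∑ j ∈ Finset.range K, (cfLaw θ).real (E j) := measureReal_biUnion_finset_le _ _
    _ ≤ ∑ j ∈ Finset.range K, 6 * Real.exp (-(δ ^ 2 * (n : ℝ)) / (2 * (K : ℝ))) :=
      Finset.sum_le_sum hbound
    _ = _ := by
      rw [Finset.sum_const, Finset.card_range, nsmul_eq_mul]
      ring

/-! ### Choice of the gap and conclusion -/

lemma cfBlockFreq_eq (b : List ℕ+) (r n : ℕ) (x : ℝ) :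
    cfBlockFreq b r n x = cfBlockFreq b 0 n (gaussMap^[r] x) := by
  unfold cfBlockFreq
  congr 1
  refine Finset.sum_congr rfl fun i _ => ?_
  rw [zero_add, ← Function.iterate_add_apply, add_comm]

lemma measurable_cfBlockFreq (b : List ℕ+) (r n : ℕ) : Measurable (cfBlockFreq b r n) :=
  (Finset.measurable_sum _ fun _ _ => (measurable_const.indicator
    (measurableSet_cfInterval b)).comp (measurable_gaussMap.iterate _)).const_mul _

lemma abs_cfBlockFreq_sub_le_one (b : List ℕ+) (r n : ℕ) (x : ℝ) :
    |cfBlockFreq b r n x - gaussMeasure.real (cfInterval b)| ≤ 1 := by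
  have hterm : ∀ y, (cfInterval b).indicator (fun _ => (1 : ℝ)) y ∈ Icc (0 : ℝ) 1 := fun y => by
    by_cases h : y ∈ cfInterval b <;> simp [h]
  have h0 : 0 ≤ cfBlockFreq b r n x :=
    mul_nonneg (by positivity) (Finset.sum_nonneg fun i _ => (hterm _).1)
  have h1 : cfBlockFreq b r n x ≤ 1 := by
    unfold cfBlockFreq
    have hsum := Finset.sum_le_card_nsmul (Finset.range n)
      (fun i => (cfInterval b).indicator (fun _ => (1 : ℝ)) (gaussMap^[r + i] x)) 1
      fun i _ => (hterm _).2
    rw [Finset.card_range, nsmul_eq_mul, mul_one] at hsum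
    rw [one_div, ← div_eq_inv_mul]
    exact div_le_one_of_le₀ hsum n.cast_nonneg
  rw [abs_le]
  constructor <;>
    linarith [measureReal_nonneg (μ := gaussMeasure) (s := cfInterval b),
      measureReal_le_one (μ := gaussMeasure) (s := cfInterval b)]

lemma exists_gap {k : ℕ} {δ M : ℝ} (hδ : 0 < δ) (hδ1 : δ < 1)
    (hM : (⌈(k : ℝ) - Real.log (δ ^ 2 / (2 * Real.log 2))⌉ : ℝ) ≤ M) :
    ∃ m : ℕ, 0 < m + k ∧ ((m + k : ℕ) : ℝ) ≤ M ∧ (1 / 2 : ℝ) ^ m ≤ 2 * δ := by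
  have hlog2 := Real.log_two_gt_d9
  have hδ2 : 0 < δ ^ 2 := by positivity
  have hq : 0 < δ ^ 2 / (2 * Real.log 2) := by positivity
  have hlt : δ ^ 2 / (2 * Real.log 2) < 1 := by
    rw [div_lt_one (by positivity)]
    nlinarith
  have hneg := Real.log_neg hq hlt
  set L := Real.log (δ ^ 2 / (2 * Real.log 2)) with hL
  have hceil := Int.le_ceil ((k : ℝ) - L)
  -- As δ < 1 and 2 log 2 > 1, the logarithm L is negative, so the gap m = ⌈k - L⌉ - k is positive.
  have hk : (k : ℤ) < ⌈(k : ℝ) - L⌉ := by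
    rw [Int.lt_ceil]
    push_cast
    linarith
  obtain ⟨m, hm⟩ := Int.eq_ofNat_of_zero_le (sub_nonneg.2 hk.le)
  have hmk : ⌈(k : ℝ) - L⌉ = ((m + k : ℕ) : ℤ) := by
    push_cast
    linarith
  rw [hmk] at hceil hM hk
  refine ⟨m, by omega, by exact_mod_cast hM, ?_⟩
  have hmL : -(m : ℝ) ≤ L := by
    push_cast at hceil
    linarith
  have hexp : Real.exp (-(m : ℝ)) ≤ δ ^ 2 / (2 * Real.log 2) := by
    rw [← Real.exp_log hq]
    exact Real.exp_le_exp.2 hmL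
  -- Since e < 4, the bound e^{-m} ≤ δ² gives (2^{-m})² ≤ δ², more than needed.
  have h4 : (1 / 4 : ℝ) ^ m ≤ Real.exp (-(m : ℝ)) := by
    rw [show -(m : ℝ) = m * (-1 : ℝ) by ring, Real.exp_nat_mul]
    gcongr
    rw [Real.exp_neg, one_div]
    exact inv_anti₀ (Real.exp_pos 1) (by linarith [Real.exp_one_lt_d9])
  have h5 : δ ^ 2 / (2 * Real.log 2) ≤ δ ^ 2 := div_le_self hδ2.le (by linarith)
  refine (pow_le_pow_iff_left₀ (by positivity) (by positivity) two_ne_zero).1 ?_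
  rw [← pow_mul, mul_comm m 2, pow_mul, mul_pow]
  norm_num at h4 ⊢
  linarith

theorem mainTheorem4 (a b : List ℕ+) (hb : b ≠ [])
    (δ : ℝ) (hδ : 0 < δ) (n : ℕ) (hn : 0 < n)
    (M : ℝ) (hMpos : 0 < M)
    (hM : (⌈(b.length : ℝ) - Real.log (δ ^ 2 / (2 * Real.log 2))⌉ : ℝ) ≤ M) :
    MeasureTheory.volume.real
        {x : ℝ | x ∈ cfInterval a ∧
          |cfBlockFreq b a.length n x - gaussMeasure.real (cfInterval b)| > δ}
      ≤ 6 * M * Real.exp (-(δ ^ 2 * (n : ℝ)) / (2 * M))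
          * MeasureTheory.volume.real (cfInterval a) := by
  -- Frequencies and probabilities lie in [0, 1], so for δ ≥ 1 no point deviates by more than δ.
  rcases le_or_gt 1 δ with hδ1 | hδ1
  · have hempty : {x : ℝ | x ∈ cfInterval a ∧
        |cfBlockFreq b a.length n x - gaussMeasure.real (cfInterval b)| > δ} = ∅ := by
      rw [eq_empty_iff_forall_notMem]
      rintro x ⟨-, hx⟩
      linarith [abs_cfBlockFreq_sub_le_one b a.length n x]
    rw [hempty, measureReal_empty]
    positivity
  obtain ⟨m, hK, hKM, hm⟩ := exists_gap hδ hδ1 hM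
  obtain ⟨θ, hθ, hcond⟩ := exists_cfLaw_cfInterval_inter a (left_mem_Icc.2 zero_le_one)
  set B : Set ℝ := {y | |cfBlockFreq b 0 n y - gaussMeasure.real (cfInterval b)| > δ} with hB
  have hBm : MeasurableSet B :=
    measurableSet_lt measurable_const ((measurable_cfBlockFreq b 0 n).sub_const _).abs
  have hset : {x : ℝ | x ∈ cfInterval a ∧
      |cfBlockFreq b a.length n x - gaussMeasure.real (cfInterval b)| > δ} =
      cfInterval a ∩ gaussMap^[a.length] ⁻¹' B := by
    ext x
    simp only [hB, mem_ofPred_eq, mem_inter_iff, mem_preimage, cfBlockFreq_eq b a.length]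
  have hvol : ∀ S ⊆ cfInterval a, cfLaw 0 S = volume S := fun S hS => by
    rw [cfLaw_zero, Measure.restrict_eq_self _ (hS.trans (cfInterval_subset a))]
  have hmain := hcond B hBm
  rw [hvol _ inter_subset_left, hvol _ subset_rfl] at hmain
  rw [hset, measureReal_def, hmain, ENNReal.toReal_mul, mul_comm]
  refine mul_le_mul_of_nonneg_right ?_ ENNReal.toReal_nonneg
  refine (cfLaw_real_deviation_le b hδ hδ1 hn m hK hm hθ).trans ?_
  have hK' : (0 : ℝ) < (m + b.length : ℕ) := by exact_mod_cast hK
  -- Both factors of 6M exp(-δ²n/(2M)) increase with M, so K ≤ M suffices.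
  rw [neg_div, neg_div]
  gcongr
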